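/- Conventions. A (concrete) operator space is a closed subspace $X$ of $B(H)$, $H$ a complex Hilbert space; $M_n(X)$ carries the norm inherited from $M_n(B(H)) = B(H\oplus_2\cdots\oplus_2 H)$. A linear map $u : X \to Y$ is completely bounded if $\sup_n \|I_{M_n}\otimes u : M_n(X)\to M_n(Y)\| < \infty$. $X$ and $Y$ are completely isomorphic if there is a completely bounded linear bijection $u : X\to Y$ with completely bounded inverse; $X$ embeds completely isomorphically into $Y$ if $X$ is completely isomorphic to a closed subspace of $Y$. Let $\mathbf{R}$ and $\mathbf{C}$ be the row and column operator spaces, i.e. $\ell_2$ realised in $B(\ell_2)$ by $\xi\mapsto\sum_j \xi_j E_{1j}$ and $\xi\mapsto\sum_i\xi_i E_{i1}$ respectively, and let $\mathbf{R}\oplus\mathbf{C}\subset B(\ell_2\oplus_2\ell_2)$. For a sequence $\alpha=(\alpha_i)_{i\in\mathbb N}$ in $[0,1]$ let $$X^d(\alpha)=\{(\xi,\operatorname{diag}(\alpha)\xi):\xi\in\ell_2\}\subset\mathbf{R}\oplus\mathbf{C}.$$ Let $\mathcal S$ be the set of sequences with $1\ge\alpha_1\ge\alpha_2\ge\dots\ge0$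 and $\lim_i\alpha_i=0$. For $\alpha,\beta\in\mathcal S$ write $\alpha\prec\beta$ (equivalently $\beta\succ\alpha$) if there are a set $S\subset\mathbb N$ and a constant $K>0$ such that $\sum_{i\in S}\alpha_i^2<\infty$ and $\alpha_i\le K\beta_i$ for all $i\notin S$. Write $\alpha\sim\beta$ if $\alpha\prec\beta$ and $\beta\prec\alpha$. Theorem. Let $\alpha,\beta\in\mathcal S$. Then $X^d(\alpha)$ embeds completely isomorphically into $X^d(\beta)$ if and only if $\alpha\prec\beta$. Moreover, the following are equivalent: 1. $X^d(\alpha)$ is completely isomorphic to $X^d(\beta)$; 2. $X^d(\alpha)$ embeds completely isomorphically into $X^d(\beta)$, and $X^d(\beta)$ embeds completely isomorphically into $X^d(\alpha)$; 3. $\alpha\sim\beta$. -/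

import Mathlib

open Filter Topology

/-- A concrete operator space: a closed subspace of `B(H)`, for a Hilbert space `H`. -/
abbrev OperatorSpace (H : Type*) [NormedAddCommGroup H] [InnerProductSpace ℂ H] : Type _ :=
  ClosedSubmodule ℂ (H →L[ℂ] H)

namespace OperatorSpace

section General

variable {H K : Type*} [NormedAddCommGroup H] [InnerProductSpace ℂ H]
  [NormedAddCommGroup K] [InnerProductSpace ℂ K]

/-- The operator on the `ℓ₂`-direct sum of `n` copies of `H` given by an `n × n` matrix of
operators: `(blockOp v x) i = ∑ j, v i j (x j)`. -/
noncomputable def blockOp {n : ℕ} (v : Matrix (Fin n) (Fin n) (H →L[ℂ] H)) :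
    PiLp 2 (fun _ : Fin n => H) →L[ℂ] PiLp 2 (fun _ : Fin n => H) :=
  (PiLp.continuousLinearEquiv 2 ℂ (fun _ : Fin n => H)).symm.toContinuousLinearMap ∘L
    ContinuousLinearMap.pi (fun i =>
      ∑ j, (v i j) ∘L PiLp.proj (𝕜 := ℂ) 2 (fun _ : Fin n => H) j)

theorem blockOp_apply {n : ℕ} (v : Matrix (Fin n) (Fin n) (H →L[ℂ] H))
    (x : PiLp 2 (fun _ : Fin n => H)) (i : Fin n) : blockOp v x i = ∑ j, v i j (x j) := by
  simp [blockOp]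

/-- The norm of `M_n(X)`, inherited from `M_n(B(H)) = B(H ⊕₂ ⋯ ⊕₂ H)`. -/
noncomputable def matNorm (X : OperatorSpace H) {n : ℕ}
    (v : Matrix (Fin n) (Fin n) X.toSubmodule) : ℝ :=
  ‖blockOp (v.map (fun x => (x : H →L[ℂ] H)))‖

/-- A linear map `u : X → Y` is completely bounded if the norms of its amplifications
`M_n(X) → M_n(Y)`, which apply `u` entrywise, are bounded uniformly in `n`. -/
def CompletelyBounded (X : OperatorSpace H) (Y : OperatorSpace K)
    (u : X.toSubmodule →ₗ[ℂ] Y.toSubmodule) : Prop :=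
  ∃ C : ℝ, ∀ (n : ℕ) (v : Matrix (Fin n) (Fin n) X.toSubmodule),
    matNorm Y (v.map u) ≤ C * matNorm X v

/-- `X` and `Y` are completely isomorphic: there is a completely bounded linear bijection
`X → Y` with completely bounded inverse. -/
def CompletelyIsomorphic (X : OperatorSpace H) (Y : OperatorSpace K) : Prop :=
  ∃ u : X.toSubmodule ≃ₗ[ℂ] Y.toSubmodule,
    CompletelyBounded X Y u.toLinearMap ∧ CompletelyBounded Y X u.symm.toLinearMap

/-- `X` embeds completely isomorphically into `Y`: it is completely isomorphic to a (closed)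
subspace of `Y`. -/
def CompletelyEmbeds (X : OperatorSpace H) (Y : OperatorSpace K) : Prop :=
  ∃ Z : OperatorSpace K, Z ≤ Y ∧ CompletelyIsomorphic X Z

/-- The direct sum of two operators, acting on the Hilbert space `H ⊕₂ K`. -/
noncomputable def dirSum (S : H →L[ℂ] H) (T : K →L[ℂ] K) :
    WithLp 2 (H × K) →L[ℂ] WithLp 2 (H × K) :=
  (WithLp.prodContinuousLinearEquiv 2 ℂ H K).symm.toContinuousLinearMap ∘L
    (S.prodMap T) ∘L (WithLp.prodContinuousLinearEquiv 2 ℂ H K).toContinuousLinearMap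

end General

/-- The complex Hilbert space `ℓ₂` of square-summable sequences indexed by `ℕ`. -/
abbrev Ell2 : Type := lp (fun _ : ℕ => ℂ) 2

/-- The row operator `∑ j, ξ j • E_{0j}` of `ξ`, that is `ζ ↦ (∑ j, ξ j * ζ j) e₀`. The space `R`
consists of these operators. (The inner product is conjugate-linear in its first argument.) -/
noncomputable def rowOp (ξ : Ell2) : Ell2 →L[ℂ] Ell2 :=
  (innerSL ℂ (star ξ)).smulRight (lp.single 2 0 (1 : ℂ))

/-- The column operator `∑ i, ξ i • E_{i0}` of `ξ`, that is `ζ ↦ ζ 0 • ξ`. The space `C` consists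
of these operators. -/
noncomputable def colOp (ξ : Ell2) : Ell2 →L[ℂ] Ell2 :=
  (innerSL ℂ (lp.single 2 0 (1 : ℂ) : Ell2)).smulRight ξ

theorem rowOp_apply (ξ ζ : Ell2) : rowOp ξ ζ = (∑' j, ξ j * ζ j) • lp.single 2 0 (1 : ℂ) := by
  simp [rowOp, lp.inner_eq_tsum, mul_comm]

theorem colOp_apply (ξ ζ : Ell2) : colOp ξ ζ = ζ 0 • ξ := by
  simp [colOp, lp.inner_single_left]

/-- The linear map `ξ ↦ (ξ, A ξ)` from `ℓ₂` to `R ⊕ C ⊆ B(ℓ₂ ⊕₂ ℓ₂)`. -/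
noncomputable def graphMap (A : Ell2 →L[ℂ] Ell2) :
    Ell2 →ₗ[ℂ] (WithLp 2 (Ell2 × Ell2) →L[ℂ] WithLp 2 (Ell2 × Ell2)) where
  toFun ξ := dirSum (rowOp ξ) (colOp (A ξ))
  map_add' ξ η := by
    ext x : 1
    apply (WithLp.equiv 2 _).injective
    ext1
    · simp [dirSum, rowOp, add_smul]
    · simp [dirSum, colOp]
  map_smul' c ξ := by
    ext x : 1
    apply (WithLp.equiv 2 _).injective
    ext1
    · simp [dirSum, rowOp, mul_smul]
    · simp [dirSum, colOp, smul_comm c]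

theorem norm_le_norm_graphMap (A : Ell2 →L[ℂ] Ell2) (ξ : Ell2) : ‖ξ‖ ≤ ‖graphMap A ξ‖ := by
  have hrow : ‖rowOp ξ‖ = ‖ξ‖ := by simp [rowOp]
  rw [← hrow]
  refine ContinuousLinearMap.opNorm_le_bound _ (norm_nonneg _) fun ζ => ?_
  have h := (graphMap A ξ).le_opNorm (WithLp.toLp 2 (ζ, 0))
  have h1 : graphMap A ξ (WithLp.toLp 2 (ζ, 0)) = WithLp.toLp 2 (rowOp ξ ζ, 0) := by
    apply (WithLp.equiv 2 _).injective
    ext1 <;> simp [graphMap, dirSum]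
  simpa [h1] using h

theorem continuous_graphMap (A : Ell2 →L[ℂ] Ell2) : Continuous (graphMap A) := by
  have hrow (ξ : Ell2) : ‖rowOp ξ‖ = ‖ξ‖ := by simp [rowOp]
  have hcol (ξ : Ell2) : ‖colOp ξ‖ = ‖ξ‖ := by simp [colOp]
  refine AddMonoidHomClass.continuous_of_bound (graphMap A) (1 + ‖A‖) fun ξ => ?_
  refine ContinuousLinearMap.opNorm_le_bound _ (by positivity) fun x => ?_
  have h1 : graphMap A ξ x =
      WithLp.toLp 2 (rowOp ξ x.fst, 0) + WithLp.toLp 2 (0, colOp (A ξ) x.snd) := by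
    apply (WithLp.equiv 2 _).injective
    ext1 <;> simp [graphMap, dirSum]
  have h2 : ‖rowOp ξ x.fst‖ ≤ ‖ξ‖ * ‖x‖ :=
    ((rowOp ξ).le_opNorm _).trans
      (by rw [hrow]; gcongr; exact WithLp.norm_fst_le _ x)
  have h3 : ‖colOp (A ξ) x.snd‖ ≤ ‖A‖ * ‖ξ‖ * ‖x‖ :=
    ((colOp (A ξ)).le_opNorm _).trans
      (by rw [hcol]; gcongr; exacts [A.le_opNorm _, WithLp.norm_snd_le _ x])
  rw [h1]
  refine (norm_add_le _ _).trans ?_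
  simp only [WithLp.norm_toLp_fst, WithLp.norm_toLp_snd]
  linarith

theorem isClosed_range_graphMap (A : Ell2 →L[ℂ] Ell2) :
    IsClosed (LinearMap.range (graphMap A) :
      Set (WithLp 2 (Ell2 × Ell2) →L[ℂ] WithLp 2 (Ell2 × Ell2))) := by
  have h : AntilipschitzWith 1 (graphMap A) :=
    AddMonoidHomClass.antilipschitz_of_bound (graphMap A) fun ξ => by
      simpa using norm_le_norm_graphMap A ξ
  have hu : UniformContinuous (graphMap A) :=
    uniformContinuous_addMonoidHom_of_continuous (continuous_graphMap A)
  rw [LinearMap.coe_range]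
  exact h.isClosed_range hu

/-- The operator space `X(A) = {(ξ, A ξ) : ξ ∈ ℓ₂} ⊆ R ⊕ C`. -/
noncomputable def graphSpace (A : Ell2 →L[ℂ] Ell2) : OperatorSpace (WithLp 2 (Ell2 × Ell2)) where
  toSubmodule := LinearMap.range (graphMap A)
  isClosed' := isClosed_range_graphMap A

/-- The diagonal operator on `ℓ₂` with diagonal `α`. -/
noncomputable def diagOp (α : ℕ → unitInterval) : Ell2 →L[ℂ] Ell2 :=
  lp.mapCLM 2 (fun i => ((α i : ℝ) : ℂ) • ContinuousLinearMap.id ℂ ℂ) zero_le_one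
    (fun i => by simpa [norm_smul, abs_of_nonneg (α i).2.1] using (α i).2.2)

theorem diagOp_apply (α : ℕ → unitInterval) (ξ : Ell2) (i : ℕ) :
    diagOp α ξ i = ((α i : ℝ) : ℂ) * ξ i := by
  simp [diagOp]

/-- The operator space `X^d(α) = X(diag α)`. -/
noncomputable def diagSpace (α : ℕ → unitInterval) : OperatorSpace (WithLp 2 (Ell2 × Ell2)) :=
  graphSpace (diagOp α)

end OperatorSpace

/-- The set of non-increasing sequences in `[0, 1]` that converge to `0`. -/
def nullSequences : Set (ℕ → unitInterval) :=
  {α | Antitone α ∧ Tendsto (fun i => (α i : ℝ)) atTop (𝓝 0)}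

/-- `α ≺ β`: off a set `S` on which `α` is square-summable, `α` is bounded by a constant
multiple of `β`. -/
def SeqDominated (α β : ℕ → unitInterval) : Prop :=
  ∃ (S : Set ℕ) (K : ℝ), 0 < K ∧ Summable (fun i : S => (α i : ℝ) ^ 2) ∧
    ∀ i ∉ S, (α i : ℝ) ≤ K * (β i : ℝ)

/-- `α ∼ β`: each of the two sequences dominates the other. -/
def SeqEquiv (α β : ℕ → unitInterval) : Prop :=
  SeqDominated β α ∧ SeqDominated α β

/-! ### Eigenvalue comparison for Hermitian operators -/

section EigenvalueComparison

open Module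

variable {E : Type*} [NormedAddCommGroup E] [InnerProductSpace ℂ E] [FiniteDimensional ℂ E] {n : ℕ}

/-! Write `X(A)` for the graph space of `A`. The norm of a matrix `w` over `ℓ₂` in `X(A)` is the
larger of its row norm and the column norm of `A w`. Bounded operators act completely boundedly on
`R` and on `C`, and a Hilbert–Schmidt diagonal operator is completely bounded from `R` to `C`. Hence
only the size of `A` modulo Hilbert–Schmidt operators matters.

Necessity. An embedding comes from a bounded `T` on `ℓ₂`. A column whose entries `g i` are
orthonormal has row norm at most 1, while applying `A` gives column norm `√(∑ ‖A (g i)‖²)`. So `∑ ‖A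
(g i)‖² ≤ c + K ∑ ‖B (T (g i))‖²` (`CompletelyEmbeds.exists_clm`). Compressed to the first `n`
coordinates, this bounds the trace of the positive part of a difference of Hermitian matrices. Weyl
monotonicity turns it into a bound on sums of eigenvalue differences
(`LinearMap.IsSymmetric.sum_eigenvalues_sub_le`), and min-max replaces the eigenvalues by `α i ^ 2`
and a multiple of `β i ^ 2`. Thus the sums of `α i ^ 2 - K' * β i ^ 2` over finite sets are bounded,
which gives `α ≺ β`.

Sufficiency. If `α ≺ β`, a diagonal contraction `t` makes `β t` comparable to `α` off `S`, but `diag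
t` need not be bounded below. Adding `2 V`, with `V` an isometry onto coordinates where `β` is
square-summable, repairs this and changes `diag β ∘ T` only by a Hilbert–Schmidt operator. If `α ∼
β`, the identity of `ℓ₂` already induces a complete isomorphism. -/

theorem LinearMap.IsSymmetric.re_inner_apply_self_eq_sum {T : E →ₗ[ℂ] E} (hT : T.IsSymmetric)
    (hn : finrank ℂ E = n) (x : E) :
    (inner ℂ (T x) x).re =
      ∑ j, hT.eigenvalues hn j * ‖(hT.eigenvectorBasis hn).repr x j‖ ^ 2 := by
  rw [← OrthonormalBasis.sum_inner_mul_inner (hT.eigenvectorBasis hn), Complex.re_sum]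
  refine Finset.sum_congr rfl fun j _ => ?_
  rw [hT x, hT.apply_eigenvectorBasis, OrthonormalBasis.repr_apply_apply, inner_smul_right,
    ← inner_conj_symm x, RCLike.ofReal_eq_complex_ofReal, mul_assoc, Complex.re_ofReal_mul,
    mul_comm (starRingEnd ℂ _), Complex.mul_conj, Complex.ofReal_re, Complex.normSq_eq_norm_sq]

/-- The dimension count behind min-max: there are `(n - 1 - i) + i = n - 1` equations in dimension
`n`. -/
theorem exists_ne_zero_of_finrank_eq (hn : finrank ℂ E = n) (i : Fin n)
    (φ : E →ₗ[ℂ] ({j : Fin n // i < j} → ℂ)) (ψ : E →ₗ[ℂ] ({j : Fin n // j < i} → ℂ)) :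
    ∃ x, x ≠ 0 ∧ φ x = 0 ∧ ψ x = 0 := by
  have hlt : finrank ℂ (({j : Fin n // i < j} → ℂ) × ({j : Fin n // j < i} → ℂ)) <
      finrank ℂ E := by
    rw [finrank_prod, finrank_pi, finrank_pi, hn]
    have h1 : Fintype.card {j : Fin n // i < j} = n - 1 - i := by
      rw [← Fin.card_Ioi i, Fintype.card_subtype]
      congr 1
      ext; simp
    have h2 : Fintype.card {j : Fin n // j < i} = i := by
      rw [← Fin.card_Iio i, Fintype.card_subtype]
      congr 1
      ext; simp
    omega
  obtain ⟨x, hx, hx0⟩ := Submodule.exists_mem_ne_zero_of_ne_bot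
    (LinearMap.ker_ne_bot_of_finrank_lt (f := φ.prod ψ) hlt)
  exact ⟨x, hx0, Prod.mk_eq_zero.1 hx⟩

/-- If the quadratic form of `T` is at least `c` on a subspace cut out by the equations with
indices beyond `i`, then the `i`-th largest eigenvalue of `T` is at least `c`. -/
theorem LinearMap.IsSymmetric.le_eigenvalues {T : E →ₗ[ℂ] E} (hT : T.IsSymmetric)
    (hn : finrank ℂ E = n) (i : Fin n) (c : ℝ) (φ : E →ₗ[ℂ] ({j : Fin n // i < j} → ℂ))
    (h : ∀ x, φ x = 0 → c * ‖x‖ ^ 2 ≤ (inner ℂ (T x) x).re) :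
    c ≤ hT.eigenvalues hn i := by
  set b := hT.eigenvectorBasis hn
  -- Eigenvalues are listed in decreasing order, so on the kernel of `ψ` the form is at most the
  -- `i`-th eigenvalue times `‖x‖ ^ 2`.
  let ψ : E →ₗ[ℂ] ({j : Fin n // j < i} → ℂ) :=
    LinearMap.pi fun j => (EuclideanSpace.proj (j : Fin n)).toLinearMap ∘ₗ b.repr.toLinearMap
  obtain ⟨x, hx0, hφ, hψ⟩ := exists_ne_zero_of_finrank_eq hn i φ ψ
  have hpos : 0 < ‖x‖ ^ 2 := by positivity
  refine le_of_mul_le_mul_right ((h x hφ).trans ?_) hpos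
  rw [hT.re_inner_apply_self_eq_sum hn, ← b.repr.norm_map x, EuclideanSpace.norm_sq_eq,
    Finset.mul_sum]
  refine Finset.sum_le_sum fun j _ => ?_
  rcases lt_or_ge j i with hj | hj
  · have : b.repr x j = 0 := congrFun hψ ⟨j, hj⟩
    simp [b] at this
    simp [b, this]
  · gcongr
    exact hT.eigenvalues_antitone hn hj

/-- If the quadratic form of `T` is at most `c` on a subspace cut out by `i` equations, then the
`i`-th largest eigenvalue of `T` is at most `c`. -/
theorem LinearMap.IsSymmetric.eigenvalues_le {T : E →ₗ[ℂ] E} (hT : T.IsSymmetric)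
    (hn : finrank ℂ E = n) (i : Fin n) (c : ℝ) (φ : E →ₗ[ℂ] ({j : Fin n // j < i} → ℂ))
    (h : ∀ x, φ x = 0 → (inner ℂ (T x) x).re ≤ c * ‖x‖ ^ 2) :
    hT.eigenvalues hn i ≤ c := by
  set b := hT.eigenvectorBasis hn
  let ψ : E →ₗ[ℂ] ({j : Fin n // i < j} → ℂ) :=
    LinearMap.pi fun j => (EuclideanSpace.proj (j : Fin n)).toLinearMap ∘ₗ b.repr.toLinearMap
  obtain ⟨x, hx0, hψ, hφ⟩ := exists_ne_zero_of_finrank_eq hn i ψ φ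
  have hpos : 0 < ‖x‖ ^ 2 := by positivity
  refine le_of_mul_le_mul_right (le_trans ?_ (h x hφ)) hpos
  rw [hT.re_inner_apply_self_eq_sum hn, ← b.repr.norm_map x, EuclideanSpace.norm_sq_eq,
    Finset.mul_sum]
  refine Finset.sum_le_sum fun j _ => ?_
  rcases lt_or_ge i j with hj | hj
  · have : b.repr x j = 0 := congrFun hψ ⟨j, hj⟩
    simp [b] at this
    simp [b, this]
  · gcongr
    exact hT.eigenvalues_antitone hn hj

/-- Weyl's monotonicity principle. -/
theorem LinearMap.IsSymmetric.eigenvalues_mono {S T : E →ₗ[ℂ] E} (hS : S.IsSymmetric)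
    (hT : T.IsSymmetric) (hn : finrank ℂ E = n)
    (h : ∀ x, (inner ℂ (S x) x).re ≤ (inner ℂ (T x) x).re) (i : Fin n) :
    hS.eigenvalues hn i ≤ hT.eigenvalues hn i := by
  set b := hS.eigenvectorBasis hn
  -- The test subspace is spanned by the eigenvectors of `S` with index up to `i`.
  refine hT.le_eigenvalues hn i _ (LinearMap.pi fun j =>
    (EuclideanSpace.proj (j : Fin n)).toLinearMap ∘ₗ b.repr.toLinearMap) fun x hx =>
    le_trans ?_ (h x)
  rw [hS.re_inner_apply_self_eq_sum hn, ← b.repr.norm_map x, EuclideanSpace.norm_sq_eq,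
    Finset.mul_sum]
  refine Finset.sum_le_sum fun j _ => ?_
  rcases lt_or_ge i j with hj | hj
  · have : b.repr x j = 0 := congrFun hx ⟨j, hj⟩
    simp [b] at this
    simp [b, this]
  · gcongr
    exact hS.eigenvalues_antitone hn hj

/-- The operator with prescribed real eigenvalues in a given orthonormal basis. -/
theorem OrthonormalBasis.exists_isSymmetric_diagonal {ι V : Type*} [Fintype ι]
    [NormedAddCommGroup V] [InnerProductSpace ℂ V] (b : OrthonormalBasis ι ℂ V) (r : ι → ℝ) :
    ∃ H : V →ₗ[ℂ] V, H.IsSymmetric ∧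
      (∀ x, (inner ℂ (H x) x).re = ∑ p, r p * ‖b.repr x p‖ ^ 2) ∧
      (LinearMap.trace ℂ V H).re = ∑ p, r p := by
  classical
  let H : V →ₗ[ℂ] V := ∑ p, (r p : ℂ) • (innerSL ℂ (b p)).toLinearMap.smulRight (b p)
  have hH (x : V) : H x = ∑ p, (r p : ℂ) • inner ℂ (b p) x • b p := by
    simp [H, LinearMap.sum_apply]
  refine ⟨H, fun x y => ?_, fun x => ?_, ?_⟩
  · simp only [hH, sum_inner, inner_sum, inner_smul_left, inner_smul_right]
    refine Finset.sum_congr rfl fun p _ => ?_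
    rw [inner_conj_symm, Complex.conj_ofReal]
    ring
  · simp only [hH, sum_inner, inner_smul_left, Complex.re_sum, OrthonormalBasis.repr_apply_apply]
    refine Finset.sum_congr rfl fun p _ => ?_
    rw [Complex.conj_ofReal, Complex.re_ofReal_mul, mul_comm (starRingEnd ℂ _),
      Complex.mul_conj, Complex.ofReal_re, Complex.normSq_eq_norm_sq]
  · rw [LinearMap.trace_eq_sum_inner H b, Complex.re_sum]
    refine Finset.sum_congr rfl fun p _ => ?_
    rw [hH, inner_sum, Finset.sum_eq_single p]
    · rw [inner_smul_right, inner_smul_right]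
      simp
    · intro q _ hq
      rw [inner_smul_right, inner_smul_right, b.inner_eq_zero hq.symm, mul_zero, mul_zero]
    · simp

/-- If the sums `∑ ⟪(S - T) f, f⟫` over orthonormal systems are bounded by `c`, so are the sums of
differences of eigenvalues of `S` and `T`. -/
theorem LinearMap.IsSymmetric.sum_eigenvalues_sub_le {S T : E →ₗ[ℂ] E} (hS : S.IsSymmetric)
    (hT : T.IsSymmetric) (hn : finrank ℂ E = n) {c : ℝ}
    (h : ∀ (b : OrthonormalBasis (Fin n) ℂ E) (s : Finset (Fin n)),
      ∑ p ∈ s, ((inner ℂ (S (b p)) (b p)).re - (inner ℂ (T (b p)) (b p)).re) ≤ c)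
    (s : Finset (Fin n)) :
    ∑ i ∈ s, (hS.eigenvalues hn i - hT.eigenvalues hn i) ≤ c := by
  classical
  have hD : (S - T).IsSymmetric := hS.sub hT
  set b := hD.eigenvectorBasis hn
  set d := hD.eigenvalues hn
  -- `H` is the positive part of `S - T`, so `T + H` dominates both `S` and `T`. All eigenvalue
  -- differences between `T + H` and `T` are then nonnegative, and they add up to the trace of `H`.
  obtain ⟨H, hH, hHin, hHtr⟩ := b.exists_isSymmetric_diagonal (fun p => max (d p) 0)
  have hL : (T + H).IsSymmetric := hT.add hH
  have hTL (i) : hT.eigenvalues hn i ≤ hL.eigenvalues hn i := by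
    refine hT.eigenvalues_mono hL hn (fun x => ?_) i
    rw [LinearMap.add_apply, inner_add_left, Complex.add_re, hHin]
    exact le_add_of_nonneg_right (Finset.sum_nonneg fun p _ => by positivity)
  have hSL (i) : hS.eigenvalues hn i ≤ hL.eigenvalues hn i := by
    refine hS.eigenvalues_mono hL hn (fun x => ?_) i
    have h1 := hD.re_inner_apply_self_eq_sum hn x
    rw [LinearMap.sub_apply, inner_sub_left, Complex.sub_re] at h1
    rw [LinearMap.add_apply, inner_add_left, Complex.add_re, hHin]
    have : ∑ j, d j * ‖b.repr x j‖ ^ 2 ≤ ∑ j, max (d j) 0 * ‖b.repr x j‖ ^ 2 := by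
      gcongr
      exact le_max_left _ _
    linarith
  have htr : ∑ i, (hL.eigenvalues hn i - hT.eigenvalues hn i) = ∑ p, max (d p) 0 := by
    rw [Finset.sum_sub_distrib]
    have h1 := hL.re_trace_eq_sum_eigenvalues hn
    have h2 := hT.re_trace_eq_sum_eigenvalues hn
    simp only [map_add] at h1
    simp at h1 h2
    linarith
  have hc : ∑ p, max (d p) 0 ≤ c := by
    -- The trace of the positive part is the sum in the hypothesis for an eigenbasis of `S - T`,
    -- restricted to positive eigenvalues.
    refine le_trans (le_of_eq ?_) (h b (Finset.univ.filter fun p => 0 < d p))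
    rw [Finset.sum_filter]
    refine Finset.sum_congr rfl fun p _ => ?_
    have h1 : (inner ℂ (S (b p)) (b p)).re - (inner ℂ (T (b p)) (b p)).re = d p := by
      rw [← Complex.sub_re, ← inner_sub_left, ← LinearMap.sub_apply, hD.apply_eigenvectorBasis,
        inner_smul_left, b.inner_eq_one]
      simp [d]
    rw [h1]
    split_ifs with hp
    · exact max_eq_left hp.le
    · exact max_eq_right (not_lt.1 hp)
  calc ∑ i ∈ s, (hS.eigenvalues hn i - hT.eigenvalues hn i)
      ≤ ∑ i ∈ s, (hL.eigenvalues hn i - hT.eigenvalues hn i) := by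
        gcongr with i
        exact hSL i
    _ ≤ ∑ i, (hL.eigenvalues hn i - hT.eigenvalues hn i) :=
        Finset.sum_le_univ_sum_of_nonneg fun i => sub_nonneg.2 (hTL i)
    _ ≤ c := htr.trans_le hc

end EigenvalueComparison

namespace OperatorSpace

/-! ### Norms of operator matrices and direct sums -/

section Block

variable {H K : Type*} [NormedAddCommGroup H] [InnerProductSpace ℂ H]
  [NormedAddCommGroup K] [InnerProductSpace ℂ K] {n : ℕ}

theorem norm_blockOp_apply_sq (v : Matrix (Fin n) (Fin n) (H →L[ℂ] H))
    (x : PiLp 2 (fun _ : Fin n => H)) :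
    ‖blockOp v x‖ ^ 2 = ∑ i, ‖∑ j, v i j (x j)‖ ^ 2 := by
  simp [PiLp.norm_sq_eq_of_L2, blockOp_apply]

theorem sum_norm_sq_le_norm_blockOp (v : Matrix (Fin n) (Fin n) (H →L[ℂ] H)) (x : Fin n → H) :
    ∑ i, ‖∑ j, v i j (x j)‖ ^ 2 ≤ ‖blockOp v‖ ^ 2 * ∑ j, ‖x j‖ ^ 2 := by
  have h := (blockOp v).le_opNorm (WithLp.toLp 2 x)
  have h2 := pow_le_pow_left₀ (norm_nonneg _) h 2
  rwa [mul_pow, norm_blockOp_apply_sq, PiLp.norm_sq_eq_of_L2] at h2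

theorem norm_blockOp_le (v : Matrix (Fin n) (Fin n) (H →L[ℂ] H)) {c : ℝ} (hc : 0 ≤ c)
    (h : ∀ x : Fin n → H, ∑ i, ‖∑ j, v i j (x j)‖ ^ 2 ≤ c ^ 2 * ∑ j, ‖x j‖ ^ 2) :
    ‖blockOp v‖ ≤ c := by
  refine ContinuousLinearMap.opNorm_le_bound _ hc fun x => ?_
  refine le_of_sq_le_sq ?_ (by positivity)
  rw [mul_pow, norm_blockOp_apply_sq, PiLp.norm_sq_eq_of_L2]
  exact h x

theorem norm_entry_le_norm_blockOp (v : Matrix (Fin n) (Fin n) (H →L[ℂ] H)) (i j : Fin n) :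
    ‖v i j‖ ≤ ‖blockOp v‖ := by
  refine ContinuousLinearMap.opNorm_le_bound _ (blockOp v).opNorm_nonneg fun z => ?_
  refine le_of_sq_le_sq ?_ (by positivity)
  have h := sum_norm_sq_le_norm_blockOp v (Pi.single j z)
  have h1 (i) : ∑ k, v i k ((Pi.single j z : Fin n → H) k) = v i j z := by
    rw [Finset.sum_eq_single j] <;> simp +contextual
  have h2 : ∑ k, ‖(Pi.single j z : Fin n → H) k‖ ^ 2 = ‖z‖ ^ 2 := by
    rw [Finset.sum_eq_single j] <;> simp +contextual
  simp only [h1, h2] at h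
  rw [mul_pow]
  exact (Finset.single_le_sum (f := fun i => ‖v i j z‖ ^ 2) (fun _ _ => by positivity)
    (Finset.mem_univ i)).trans h

theorem norm_blockOp_fin_one_le (v : Matrix (Fin 1) (Fin 1) (H →L[ℂ] H)) :
    ‖blockOp v‖ ≤ ‖v 0 0‖ := by
  refine norm_blockOp_le v (norm_nonneg _) fun x => ?_
  simp only [Fin.sum_univ_one]
  rw [← mul_pow]
  exact pow_le_pow_left₀ (norm_nonneg _) ((v 0 0).le_opNorm _) 2

theorem norm_blockOp_add_le (v w : Matrix (Fin n) (Fin n) (H →L[ℂ] H)) :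
    ‖blockOp (v + w)‖ ≤ ‖blockOp v‖ + ‖blockOp w‖ := by
  have : blockOp (v + w) = blockOp v + blockOp w := by
    ext x i
    simp [blockOp_apply, Finset.sum_add_distrib]
  rw [this]
  exact ContinuousLinearMap.opNorm_add_le _ _

theorem dirSum_apply (S : H →L[ℂ] H) (T : K →L[ℂ] K) (x : WithLp 2 (H × K)) :
    dirSum S T x = WithLp.toLp 2 (S x.fst, T x.snd) := rfl

theorem sum_dirSum_apply (a : Fin n → H →L[ℂ] H) (b : Fin n → K →L[ℂ] K)
    (x : Fin n → WithLp 2 (H × K)) :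
    ‖∑ j, dirSum (a j) (b j) (x j)‖ ^ 2 =
      ‖∑ j, a j (x j).fst‖ ^ 2 + ‖∑ j, b j (x j).snd‖ ^ 2 := by
  have : ∑ j, dirSum (a j) (b j) (x j) =
      WithLp.toLp 2 (∑ j, a j (x j).fst, ∑ j, b j (x j).snd) := by
    simp only [dirSum_apply]
    rw [← WithLp.toLp_sum]
    congr 1
    ext <;> simp [Prod.fst_sum, Prod.snd_sum]
  rw [this, WithLp.prod_norm_sq_eq_of_L2]
  rfl

/-- By Pythagoras, the squared norms of input and output both split into the two summands, which do
not interact. -/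
theorem norm_blockOp_dirSum_le (a : Matrix (Fin n) (Fin n) (H →L[ℂ] H))
    (b : Matrix (Fin n) (Fin n) (K →L[ℂ] K)) {c : ℝ} (ha : ‖blockOp a‖ ≤ c)
    (hb : ‖blockOp b‖ ≤ c) : ‖blockOp (fun i j => dirSum (a i j) (b i j))‖ ≤ c := by
  have hc : 0 ≤ c := (blockOp a).opNorm_nonneg.trans ha
  refine norm_blockOp_le _ hc fun x => ?_
  have h1 : ∑ i, ‖∑ j, a i j (x j).fst‖ ^ 2 ≤ c ^ 2 * ∑ j, ‖(x j).fst‖ ^ 2 :=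
    (sum_norm_sq_le_norm_blockOp a _).trans
      (mul_le_mul_of_nonneg_right (pow_le_pow_left₀ (blockOp a).opNorm_nonneg ha 2)
        (Finset.sum_nonneg fun _ _ => sq_nonneg _))
  have h2 : ∑ i, ‖∑ j, b i j (x j).snd‖ ^ 2 ≤ c ^ 2 * ∑ j, ‖(x j).snd‖ ^ 2 :=
    (sum_norm_sq_le_norm_blockOp b _).trans
      (mul_le_mul_of_nonneg_right (pow_le_pow_left₀ (blockOp b).opNorm_nonneg hb 2)
        (Finset.sum_nonneg fun _ _ => sq_nonneg _))
  have h3 : ∑ j, ‖x j‖ ^ 2 = ∑ j, ‖(x j).fst‖ ^ 2 + ∑ j, ‖(x j).snd‖ ^ 2 := by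
    simp only [WithLp.prod_norm_sq_eq_of_L2, Finset.sum_add_distrib]
  simp only [sum_dirSum_apply]
  rw [h3, mul_add, Finset.sum_add_distrib]
  exact add_le_add h1 h2

theorem norm_blockOp_fst_le (a : Matrix (Fin n) (Fin n) (H →L[ℂ] H))
    (b : Matrix (Fin n) (Fin n) (K →L[ℂ] K)) :
    ‖blockOp a‖ ≤ ‖blockOp (fun i j => dirSum (a i j) (b i j))‖ := by
  refine norm_blockOp_le _ (ContinuousLinearMap.opNorm_nonneg _) fun x => ?_
  have h := sum_norm_sq_le_norm_blockOp (fun i j => dirSum (a i j) (b i j))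
    (fun j => WithLp.toLp 2 (x j, 0))
  simp only [sum_dirSum_apply] at h
  simpa using h

theorem norm_blockOp_snd_le (a : Matrix (Fin n) (Fin n) (H →L[ℂ] H))
    (b : Matrix (Fin n) (Fin n) (K →L[ℂ] K)) :
    ‖blockOp b‖ ≤ ‖blockOp (fun i j => dirSum (a i j) (b i j))‖ := by
  refine norm_blockOp_le _ (ContinuousLinearMap.opNorm_nonneg _) fun x => ?_
  have h := sum_norm_sq_le_norm_blockOp (fun i j => dirSum (a i j) (b i j))
    (fun j => WithLp.toLp 2 (0, x j))
  simp only [sum_dirSum_apply] at h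
  simpa using h

end Block

/-! ### Matrix norms over the row and column spaces -/

section RowColumn

variable {n : ℕ}

/-- The norm of a matrix over `ℓ₂` when `ℓ₂` is realised as the row space. -/
noncomputable def rowNorm (v : Matrix (Fin n) (Fin n) Ell2) : ℝ := ‖blockOp (v.map rowOp)‖

/-- The norm of a matrix over `ℓ₂` when `ℓ₂` is realised as the column space. -/
noncomputable def colNorm (v : Matrix (Fin n) (Fin n) Ell2) : ℝ := ‖blockOp (v.map colOp)‖

theorem rowNorm_nonneg (v : Matrix (Fin n) (Fin n) Ell2) : 0 ≤ rowNorm v := norm_nonneg _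

theorem colNorm_nonneg (v : Matrix (Fin n) (Fin n) Ell2) : 0 ≤ colNorm v := norm_nonneg _

theorem rowNorm_le_norm_blockOp_graphMap (A : Ell2 →L[ℂ] Ell2)
    (v : Matrix (Fin n) (Fin n) Ell2) : rowNorm v ≤ ‖blockOp (v.map (graphMap A))‖ :=
  norm_blockOp_fst_le (v.map rowOp) ((v.map A).map colOp)

theorem colNorm_le_norm_blockOp_graphMap (A : Ell2 →L[ℂ] Ell2)
    (v : Matrix (Fin n) (Fin n) Ell2) : colNorm (v.map A) ≤ ‖blockOp (v.map (graphMap A))‖ :=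
  norm_blockOp_snd_le (v.map rowOp) ((v.map A).map colOp)

theorem norm_blockOp_graphMap_le (A : Ell2 →L[ℂ] Ell2) (v : Matrix (Fin n) (Fin n) Ell2) {c : ℝ}
    (hr : rowNorm v ≤ c) (hc : colNorm (v.map A) ≤ c) :
    ‖blockOp (v.map (graphMap A))‖ ≤ c :=
  norm_blockOp_dirSum_le (v.map rowOp) ((v.map A).map colOp) hr hc

/-- The row norm expressed through the bilinear pairing of `ℓ₂` with itself. -/
theorem rowNorm_le {v : Matrix (Fin n) (Fin n) Ell2} {c : ℝ} (hc : 0 ≤ c)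
    (h : ∀ x : Fin n → Ell2,
      ∑ i, ‖∑ j, inner ℂ (star (v i j)) (x j)‖ ^ 2 ≤ c ^ 2 * ∑ j, ‖x j‖ ^ 2) :
    rowNorm v ≤ c := by
  refine norm_blockOp_le _ hc fun x => le_trans (le_of_eq ?_) (h x)
  refine Finset.sum_congr rfl fun i _ => ?_
  simp [rowOp, ← Finset.sum_smul, norm_smul]

theorem sum_norm_inner_sq_le_rowNorm (v : Matrix (Fin n) (Fin n) Ell2) (x : Fin n → Ell2) :
    ∑ i, ‖∑ j, inner ℂ (star (v i j)) (x j)‖ ^ 2 ≤ rowNorm v ^ 2 * ∑ j, ‖x j‖ ^ 2 := by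
  refine le_trans (le_of_eq ?_) (sum_norm_sq_le_norm_blockOp (v.map rowOp) x)
  refine Finset.sum_congr rfl fun i _ => ?_
  simp [rowOp, ← Finset.sum_smul, norm_smul]

/-- A column operator sees only the zeroth coordinate of its argument, so scalar test vectors
suffice. -/
theorem colNorm_le {v : Matrix (Fin n) (Fin n) Ell2} {c : ℝ} (hc : 0 ≤ c)
    (h : ∀ z : Fin n → ℂ, ∑ i, ‖∑ j, z j • v i j‖ ^ 2 ≤ c ^ 2 * ∑ j, ‖z j‖ ^ 2) :
    colNorm v ≤ c := by
  refine norm_blockOp_le _ hc fun x => ?_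
  have h1 := h fun j => x j 0
  simp only [Matrix.map_apply, colOp_apply]
  refine h1.trans ?_
  gcongr with j
  exact lp.norm_apply_le_norm two_ne_zero (x j) 0

theorem sum_norm_sq_le_colNorm (v : Matrix (Fin n) (Fin n) Ell2) (z : Fin n → ℂ) :
    ∑ i, ‖∑ j, z j • v i j‖ ^ 2 ≤ colNorm v ^ 2 * ∑ j, ‖z j‖ ^ 2 := by
  have h := sum_norm_sq_le_norm_blockOp (v.map colOp) fun j => lp.single 2 0 (z j)
  simpa [colOp_apply, colNorm] using h

theorem colNorm_add_le (v w : Matrix (Fin n) (Fin n) Ell2) :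
    colNorm (v + w) ≤ colNorm v + colNorm w := by
  have : (v + w).map colOp = v.map colOp + w.map colOp := by
    ext i j : 2
    simp [colOp]
  rw [colNorm, this]
  exact norm_blockOp_add_le _ _

/-- `C` is a homogeneous operator space. -/
theorem colNorm_map_le (T : Ell2 →L[ℂ] Ell2) (v : Matrix (Fin n) (Fin n) Ell2) :
    colNorm (v.map T) ≤ ‖T‖ * colNorm v := by
  refine colNorm_le (mul_nonneg (norm_nonneg _) (colNorm_nonneg v)) fun z => ?_
  rw [mul_pow, mul_assoc]
  refine le_trans ?_ (mul_le_mul_of_nonneg_left (sum_norm_sq_le_colNorm v z) (by positivity))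
  rw [Finset.mul_sum]
  refine Finset.sum_le_sum fun i _ => ?_
  have : ∑ j, z j • v.map T i j = T (∑ j, z j • v i j) := by simp
  rw [this, ← mul_pow]
  exact pow_le_pow_left₀ (norm_nonneg _) (T.le_opNorm _) 2

theorem inner_star_comm (ξ ζ : Ell2) : inner ℂ (star ξ) ζ = inner ℂ (star ζ) ξ := by
  simp [lp.inner_eq_tsum, mul_comm]

/-- `R` is a homogeneous operator space. -/
theorem rowNorm_map_le (T : Ell2 →L[ℂ] Ell2) (v : Matrix (Fin n) (Fin n) Ell2) :
    rowNorm (v.map T) ≤ ‖T‖ * rowNorm v := by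
  refine rowNorm_le (mul_nonneg (norm_nonneg _) (rowNorm_nonneg v)) fun x => ?_
  -- The row pairing is bilinear, so `T` moves across as its transpose, the adjoint conjugated by
  -- `star`.
  have h (ξ ζ : Ell2) : inner ℂ (star (T ξ)) ζ =
      inner ℂ (star ξ) (star (ContinuousLinearMap.adjoint T (star ζ))) := by
    rw [inner_star_comm, ← ContinuousLinearMap.adjoint_inner_left, inner_star_comm ξ, star_star]
  simp only [Matrix.map_apply, h]
  refine (sum_norm_inner_sq_le_rowNorm v _).trans ?_
  rw [mul_pow, mul_comm (‖T‖ ^ 2), mul_assoc, Finset.mul_sum _ _ (‖T‖ ^ 2)]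
  gcongr with j
  rw [← mul_pow, norm_star]
  refine pow_le_pow_left₀ (norm_nonneg _) (((ContinuousLinearMap.adjoint T).le_opNorm _).trans ?_) 2
  rw [LinearIsometryEquiv.norm_map, norm_star]

theorem hasSum_norm_sq (ξ : Ell2) : HasSum (fun i => ‖ξ i‖ ^ 2) (‖ξ‖ ^ 2) := by
  simpa using lp.hasSum_norm (p := 2) (by simp) ξ

/-- A Hilbert–Schmidt diagonal operator is completely bounded from `R` to `C`. -/
theorem colNorm_map_le_rowNorm (D : Ell2 →L[ℂ] Ell2) (d : ℕ → ℝ)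
    (hD : ∀ ξ i, ‖D ξ i‖ = d i * ‖ξ i‖) (hd : Summable fun i => d i ^ 2)
    (v : Matrix (Fin n) (Fin n) Ell2) :
    colNorm (v.map D) ≤ √(∑' i, d i ^ 2) * rowNorm v := by
  refine colNorm_le (mul_nonneg (Real.sqrt_nonneg _) (rowNorm_nonneg v)) fun z => ?_
  rw [mul_pow, Real.sq_sqrt (tsum_nonneg fun _ => sq_nonneg _), mul_assoc]
  set W : Fin n → Ell2 := fun i => ∑ j, z j • v i j
  have hW (i) : ∑ j, z j • v.map D i j = D (W i) := by simp [W]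
  simp only [hW]
  -- Testing the row norm on the vectors `z j • e_k` isolates the `k`-th coordinates of all `W i`;
  -- these bounds are then summed with weights `d k ^ 2`.
  have hk (k : ℕ) : ∑ i, ‖W i k‖ ^ 2 ≤ rowNorm v ^ 2 * ∑ j, ‖z j‖ ^ 2 := by
    have h := sum_norm_inner_sq_le_rowNorm v fun j => lp.single 2 k (z j)
    have h1 (i) : W i k = ∑ j, inner ℂ (star (v i j)) (lp.single 2 k (z j) : Ell2) := by
      have h2 := map_sum (lp.evalCLM ℂ (fun _ : ℕ => ℂ) 2 k) (fun j => z j • v i j) Finset.univ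
      refine h2.trans (Finset.sum_congr rfl fun j _ => ?_)
      simp [lp.inner_single_right, lp.evalCLM]
    simpa [← h1] using h
  have hs : HasSum (fun k => ∑ i, ‖D (W i) k‖ ^ 2) (∑ i, ‖D (W i)‖ ^ 2) :=
    hasSum_sum fun i _ => hasSum_norm_sq _
  refine hasSum_le (fun k => ?_) hs (hd.hasSum.mul_right _)
  simp only [hD, mul_pow, ← Finset.mul_sum]
  gcongr
  exact hk k

end RowColumn

/-! ### Necessity: from a complete embedding to a Hilbert–Schmidt estimate -/

section Necessity

theorem norm_graphMap_le (A : Ell2 →L[ℂ] Ell2) : ∃ c, ∀ ξ, ‖graphMap A ξ‖ ≤ c * ‖ξ‖ :=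
  ⟨‖(⟨graphMap A, continuous_graphMap A⟩ : Ell2 →L[ℂ] _)‖, fun ξ =>
    (⟨graphMap A, continuous_graphMap A⟩ : Ell2 →L[ℂ] _).le_opNorm ξ⟩

theorem graphMap_injective (A : Ell2 →L[ℂ] Ell2) : Function.Injective (graphMap A) := by
  refine (injective_iff_map_eq_zero _).2 fun ξ hξ => norm_le_zero_iff.1 ?_
  simpa [hξ] using norm_le_norm_graphMap A ξ

/-- Completely bounded maps between graph spaces come from bounded operators on `ℓ₂`. -/
theorem CompletelyBounded.exists_clm {A B : Ell2 →L[ℂ] Ell2}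
    {Z : OperatorSpace (WithLp 2 (Ell2 × Ell2))} (hZ : Z ≤ graphSpace B)
    {u : (graphSpace A).toSubmodule →ₗ[ℂ] Z.toSubmodule}
    (hu : CompletelyBounded (graphSpace A) Z u) :
    ∃ T : Ell2 →L[ℂ] Ell2, ∀ ξ, (u ((graphMap A).rangeRestrict ξ) :
      WithLp 2 (Ell2 × Ell2) →L[ℂ] WithLp 2 (Ell2 × Ell2)) = graphMap B (T ξ) := by
  obtain ⟨C, hC⟩ := hu
  obtain ⟨c, hc⟩ := norm_graphMap_le A
  let e := LinearEquiv.ofInjective (graphMap B) (graphMap_injective B)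
  let T₀ : Ell2 →ₗ[ℂ] Ell2 := e.symm.toLinearMap ∘ₗ Submodule.inclusion hZ ∘ₗ u ∘ₗ
    (graphMap A).rangeRestrict
  have hT₀ (ξ) : graphMap B (T₀ ξ) = u ((graphMap A).rangeRestrict ξ) := by
    have h := e.apply_symm_apply (Submodule.inclusion hZ (u ((graphMap A).rangeRestrict ξ)))
    exact congrArg Subtype.val h
  refine ⟨T₀.mkContinuous (|C| * c) fun ξ => ?_, fun ξ => (hT₀ ξ).symm⟩
  -- Matrices of size one already give boundedness; `|C|` appears because `C` carries no sign
  -- assumption.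
  let v : Matrix (Fin 1) (Fin 1) (graphSpace A).toSubmodule :=
    fun _ _ => (graphMap A).rangeRestrict ξ
  calc ‖T₀ ξ‖ ≤ ‖graphMap B (T₀ ξ)‖ := norm_le_norm_graphMap B _
    _ = ‖((v.map u).map fun x =>
          (x : WithLp 2 (Ell2 × Ell2) →L[ℂ] WithLp 2 (Ell2 × Ell2))) 0 0‖ := by
        rw [hT₀]; rfl
    _ ≤ matNorm Z (v.map u) := norm_entry_le_norm_blockOp _ 0 0
    _ ≤ C * matNorm (graphSpace A) v := hC 1 v
    _ ≤ |C| * matNorm (graphSpace A) v :=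
        mul_le_mul_of_nonneg_right (le_abs_self C) (ContinuousLinearMap.opNorm_nonneg _)
    _ ≤ |C| * ‖graphMap A ξ‖ :=
        mul_le_mul_of_nonneg_left (norm_blockOp_fin_one_le _) (abs_nonneg C)
    _ ≤ |C| * (c * ‖ξ‖) := mul_le_mul_of_nonneg_left (hc ξ) (abs_nonneg C)
    _ = |C| * c * ‖ξ‖ := (mul_assoc _ _ _).symm

variable {n : ℕ}

/-- The matrix over `ℓ₂` with `k`-th column `g` and zeros elsewhere. -/
noncomputable def columnMatrix (k : Fin n) (g : Fin n → Ell2) : Matrix (Fin n) (Fin n) Ell2 :=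
  fun i j => if j = k then g i else 0

theorem columnMatrix_map (k : Fin n) (g : Fin n → Ell2) (T : Ell2 →L[ℂ] Ell2) :
    (columnMatrix k g).map T = columnMatrix k fun i => T (g i) := by
  ext i j : 2
  simp only [columnMatrix, Matrix.map_apply]
  split_ifs
  · rfl
  · rw [map_zero]

theorem sum_norm_sq_le_colNorm_columnMatrix (k : Fin n) (g : Fin n → Ell2) :
    ∑ i, ‖g i‖ ^ 2 ≤ colNorm (columnMatrix k g) ^ 2 := by
  have h := sum_norm_sq_le_colNorm (columnMatrix k g) (Pi.single k 1)
  have h1 (i) : ∑ j, (Pi.single k 1 : Fin n → ℂ) j • columnMatrix k g i j = g i := by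
    rw [Finset.sum_eq_single k] <;> simp +contextual [columnMatrix]
  have h2 : ∑ j, ‖(Pi.single k 1 : Fin n → ℂ) j‖ ^ 2 = 1 := by
    rw [Finset.sum_eq_single k] <;> simp +contextual
  simpa only [h1, h2, mul_one] using h

theorem colNorm_columnMatrix_le (k : Fin n) (g : Fin n → Ell2) :
    colNorm (columnMatrix k g) ≤ √(∑ i, ‖g i‖ ^ 2) := by
  refine colNorm_le (Real.sqrt_nonneg _) fun z => ?_
  rw [Real.sq_sqrt (by positivity)]
  have h1 (i) : ∑ j, z j • columnMatrix k g i j = z k • g i := by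
    rw [Finset.sum_eq_single k] <;> simp +contextual [columnMatrix]
  simp only [h1, norm_smul, mul_pow, ← Finset.mul_sum]
  rw [mul_comm]
  gcongr
  exact Finset.single_le_sum (f := fun j => ‖z j‖ ^ 2) (fun _ _ => by positivity)
    (Finset.mem_univ k)

/-- Assuming Bessel's inequality rather than orthonormality allows some `g i` to vanish, so that
subfamilies of a basis can be padded by zeros. -/
theorem rowNorm_columnMatrix_le_one (k : Fin n) (g : Fin n → Ell2)
    (hg : ∀ ζ : Ell2, ∑ i, ‖(inner ℂ (g i) ζ : ℂ)‖ ^ 2 ≤ ‖ζ‖ ^ 2) :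
    rowNorm (columnMatrix k g) ≤ 1 := by
  refine rowNorm_le zero_le_one fun x => ?_
  have h1 (i) : ‖∑ j, (inner ℂ (star (columnMatrix k g i j)) (x j) : ℂ)‖ =
      ‖(inner ℂ (g i) (star (x k)) : ℂ)‖ := by
    rw [Finset.sum_eq_single k]
    · rw [inner_star_comm, norm_inner_symm]; simp [columnMatrix]
    · intro j _ hj; simp [columnMatrix, hj]
    · simp
  simp only [h1]
  refine (hg _).trans ?_
  rw [one_pow, one_mul, norm_star]
  exact Finset.single_le_sum (f := fun j => ‖x j‖ ^ 2) (fun _ _ => by positivity)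
    (Finset.mem_univ k)

/-- A complete embedding `X(A) → X(B)` is given by an operator `T` on `ℓ₂` such that `A` is
dominated by `B T` up to a Hilbert–Schmidt perturbation, tested on orthonormal systems. -/
theorem CompletelyEmbeds.exists_clm {A B : Ell2 →L[ℂ] Ell2}
    (h : CompletelyEmbeds (graphSpace A) (graphSpace B)) :
    ∃ (T : Ell2 →L[ℂ] Ell2) (c K : ℝ), 0 ≤ c ∧ 0 ≤ K ∧ ∀ (n : ℕ) (g : Fin n → Ell2),
      (∀ ζ : Ell2, ∑ i, ‖(inner ℂ (g i) ζ : ℂ)‖ ^ 2 ≤ ‖ζ‖ ^ 2) →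
        ∑ i, ‖A (g i)‖ ^ 2 ≤ c + K * ∑ i, ‖B (T (g i))‖ ^ 2 := by
  obtain ⟨Z, hZ, u, hu, C, hC⟩ := h
  obtain ⟨T, hT⟩ := hu.exists_clm hZ
  refine ⟨T, C ^ 2 * ‖T‖ ^ 2, C ^ 2, by positivity, by positivity, fun n g hg => ?_⟩
  rcases Nat.eq_zero_or_pos n with rfl | hn
  · simpa using by positivity
  let k : Fin n := ⟨0, hn⟩
  -- Such a column is small in `R`, while its column norm is a Hilbert–Schmidt sum; the gap between
  -- the two is what detects `A`.
  let w := columnMatrix k g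
  let v : Matrix (Fin n) (Fin n) (graphSpace A).toSubmodule := w.map (graphMap A).rangeRestrict
  have h1 : colNorm (w.map A) ≤ matNorm (graphSpace A) v := colNorm_le_norm_blockOp_graphMap A w
  have h2 : matNorm (graphSpace A) v ≤ C * matNorm Z (v.map u) := by
    have := hC n (v.map u)
    have hv : (v.map u).map u.symm.toLinearMap = v :=
      Matrix.ext fun i j => u.symm_apply_apply (v i j)
    rwa [hv] at this
  have h3 : matNorm Z (v.map u) = ‖blockOp ((w.map T).map (graphMap B))‖ := by
    exact congrArg (fun m : Matrix (Fin n) (Fin n)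
      (WithLp 2 (Ell2 × Ell2) →L[ℂ] WithLp 2 (Ell2 × Ell2)) => ‖blockOp m‖)
      (Matrix.ext fun i j => hT (w i j))
  have h4 : ‖blockOp ((w.map T).map (graphMap B))‖ ≤
      √(‖T‖ ^ 2 + ∑ i, ‖B (T (g i))‖ ^ 2) := by
    refine norm_blockOp_graphMap_le B _ ?_ ?_
    · refine (rowNorm_map_le T w).trans (Real.le_sqrt_of_sq_le ?_)
      calc (‖T‖ * rowNorm w) ^ 2 ≤ (‖T‖ * 1) ^ 2 := by
            gcongr
            · exact mul_nonneg (norm_nonneg _) (rowNorm_nonneg w)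
            · exact rowNorm_columnMatrix_le_one k g hg
        _ ≤ _ := by
            rw [mul_one]
            exact le_add_of_nonneg_right (by positivity)
    · rw [columnMatrix_map, columnMatrix_map]
      refine (colNorm_columnMatrix_le _ _).trans (Real.sqrt_le_sqrt ?_)
      exact le_add_of_nonneg_left (by positivity)
  have h5 : ∑ i, ‖A (g i)‖ ^ 2 ≤ colNorm (w.map A) ^ 2 := by
    rw [columnMatrix_map]
    exact sum_norm_sq_le_colNorm_columnMatrix k _
  calc ∑ i, ‖A (g i)‖ ^ 2 ≤ colNorm (w.map A) ^ 2 := h5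
    _ ≤ (C * ‖blockOp ((w.map T).map (graphMap B))‖) ^ 2 :=
        pow_le_pow_left₀ (colNorm_nonneg _) (h3 ▸ h1.trans h2) 2
    _ = C ^ 2 * ‖blockOp ((w.map T).map (graphMap B))‖ ^ 2 := mul_pow _ _ _
    _ ≤ C ^ 2 * (‖T‖ ^ 2 + ∑ i, ‖B (T (g i))‖ ^ 2) := by
        refine mul_le_mul_of_nonneg_left ?_ (sq_nonneg C)
        rw [← Real.sq_sqrt (x := ‖T‖ ^ 2 + ∑ i, ‖B (T (g i))‖ ^ 2) (by positivity)]
        exact pow_le_pow_left₀ (ContinuousLinearMap.opNorm_nonneg _) h4 2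
    _ = _ := mul_add _ _ _

end Necessity

end OperatorSpace

/-! ### Singular value comparison -/

section EigenvalueComparison

open Module

variable {n : ℕ} {F : Type*} [NormedAddCommGroup F] [InnerProductSpace ℂ F] [CompleteSpace F]

/-- Two operators `S`, `T` on `ℂⁿ` whose squared Hilbert–Schmidt norms on orthonormal systems
differ by at most `c`: if the singular values of `S` are at least `a` and those of `T` at most
`g`, then the partial sums of `a ^ 2 - g ^ 2` are at most `c`. -/
theorem sum_sub_le_of_orthonormalBasis (S T : EuclideanSpace ℂ (Fin n) →L[ℂ] F) {c : ℝ}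
    (h : ∀ (b : OrthonormalBasis (Fin n) ℂ (EuclideanSpace ℂ (Fin n))) (s : Finset (Fin n)),
      ∑ p ∈ s, (‖S (b p)‖ ^ 2 - ‖T (b p)‖ ^ 2) ≤ c)
    (a g : Fin n → ℝ)
    (ha : ∀ i x, (∀ j, i < j → x j = 0) → a i * ‖x‖ ^ 2 ≤ ‖S x‖ ^ 2)
    (φ : EuclideanSpace ℂ (Fin n) →ₗ[ℂ] Fin n → ℂ)
    (hg : ∀ i x, (∀ j, j < i → φ x j = 0) → ‖T x‖ ^ 2 ≤ g i * ‖x‖ ^ 2)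
    (s : Finset (Fin n)) : ∑ i ∈ s, (a i - g i) ≤ c := by
  have key (R : EuclideanSpace ℂ (Fin n) →L[ℂ] F) :
      ∃ M : EuclideanSpace ℂ (Fin n) →ₗ[ℂ] EuclideanSpace ℂ (Fin n), M.IsSymmetric ∧
        ∀ x, (inner ℂ (M x) x).re = ‖R x‖ ^ 2 := by
    refine ⟨(R.adjoint ∘L R).toLinearMap, fun x y => ?_, fun x => ?_⟩
    · simp [ContinuousLinearMap.adjoint_inner_left, ContinuousLinearMap.adjoint_inner_right]
    · have := inner_self_eq_norm_sq (𝕜 := ℂ) (R x)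
      simpa [ContinuousLinearMap.adjoint_inner_left] using this
  obtain ⟨M, hM, hMS⟩ := key S
  obtain ⟨N, hN, hNT⟩ := key T
  have hn : finrank ℂ (EuclideanSpace ℂ (Fin n)) = n := by simp
  refine le_trans (Finset.sum_le_sum fun i _ => sub_le_sub ?_ ?_)
    (hM.sum_eigenvalues_sub_le hN hn (by simpa only [hMS, hNT] using h) s)
  · refine hM.le_eigenvalues hn i _ (LinearMap.pi fun j =>
      (EuclideanSpace.proj (j : Fin n)).toLinearMap) fun x hx => ?_
    rw [hMS]
    exact ha i x fun j hj => congrFun hx ⟨j, hj⟩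
  · refine hN.eigenvalues_le hn i _ (LinearMap.pi fun j =>
      LinearMap.proj (j : Fin n) ∘ₗ φ) fun x hx => ?_
    rw [hNT]
    exact hg i x fun j hj => congrFun hx ⟨j, hj⟩

end EigenvalueComparison

namespace OperatorSpace

/-! ### Diagonal operators: deducing domination of sequences -/

section Diagonal

theorem norm_diagOp_apply (α : ℕ → unitInterval) (ξ : Ell2) (i : ℕ) :
    ‖diagOp α ξ i‖ = α i * ‖ξ i‖ := by
  rw [diagOp_apply, norm_mul, Complex.norm_real, Real.norm_of_nonneg (α i).2.1]

theorem norm_sq_diagOp_le {β : ℕ → unitInterval} (hβ : Antitone β) {i : ℕ} {ξ : Ell2}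
    (hξ : ∀ j < i, ξ j = 0) : ‖diagOp β ξ‖ ^ 2 ≤ (β i : ℝ) ^ 2 * ‖ξ‖ ^ 2 := by
  refine hasSum_le (fun j => ?_) (hasSum_norm_sq _) ((hasSum_norm_sq ξ).mul_left _)
  rw [norm_diagOp_apply, mul_pow]
  rcases lt_or_ge j i with hj | hj
  · simp [hξ j hj]
  · gcongr
    · exact (β j).2.1
    · exact hβ hj

theorem le_norm_sq_diagOp {α : ℕ → unitInterval} (hα : Antitone α) {i : ℕ} {ξ : Ell2}
    (hξ : ∀ j, i < j → ξ j = 0) : (α i : ℝ) ^ 2 * ‖ξ‖ ^ 2 ≤ ‖diagOp α ξ‖ ^ 2 := by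
  refine hasSum_le (fun j => ?_) ((hasSum_norm_sq ξ).mul_left _) (hasSum_norm_sq _)
  rw [norm_diagOp_apply, mul_pow]
  rcases lt_or_ge i j with hj | hj
  · simp [hξ j hj]
  · gcongr
    · exact (α i).2.1
    · exact hα hj

/-- The isometric embedding of `ℂⁿ` into `ℓ₂` as the first `n` coordinates. -/
theorem exists_initial_embedding (n : ℕ) :
    ∃ J : EuclideanSpace ℂ (Fin n) →ₗᵢ[ℂ] Ell2,
      (∀ x (i : Fin n), J x i = x i) ∧ ∀ x j, n ≤ j → J x j = 0 := by
  let J₀ : EuclideanSpace ℂ (Fin n) →ₗ[ℂ] Ell2 :=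
    ∑ i : Fin n, lp.lsingle 2 (i : ℕ) ∘ₗ (EuclideanSpace.proj i).toLinearMap
  have hJ (x) (j : ℕ) : J₀ x j = ∑ i : Fin n, if (i : ℕ) = j then x i else 0 := by
    have h1 : J₀ x = ∑ i : Fin n, (lp.single 2 (i : ℕ) (x i) : Ell2) := by
      simp only [J₀, LinearMap.sum_apply]
      rfl
    have h2 := map_sum (lp.evalCLM ℂ (fun _ : ℕ => ℂ) 2 j)
      (fun i : Fin n => (lp.single 2 (i : ℕ) (x i) : Ell2)) Finset.univ
    rw [h1]
    refine h2.trans (Finset.sum_congr rfl fun i _ => ?_)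
    simp [lp.evalCLM, Pi.single_apply, eq_comm]
  have h1 (x) (i : Fin n) : J₀ x i = x i := by
    rw [hJ, Finset.sum_eq_single i] <;> simp +contextual [Fin.val_inj]
  have h2 (x) (j : ℕ) (hj : n ≤ j) : J₀ x j = 0 := by
    rw [hJ]
    exact Finset.sum_eq_zero fun i _ => if_neg (by omega)
  refine ⟨⟨J₀, fun x => ?_⟩, h1, h2⟩
  rw [← sq_eq_sq₀ (norm_nonneg _) (norm_nonneg _), EuclideanSpace.norm_sq_eq]
  refine (hasSum_norm_sq (J₀ x)).unique ?_
  have : ∑ i, ‖x i‖ ^ 2 = ∑ j ∈ Finset.range n, ‖J₀ x j‖ ^ 2 := by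
    rw [Finset.sum_range]
    simp [h1]
  rw [this]
  refine hasSum_sum_of_ne_finset_zero fun j hj => ?_
  simp [h2 x j (by simpa using hj)]

/-- The constants do not depend on `n`, so the finite-dimensional comparison on the first `n`
coordinates yields a bound uniform in `s`. -/
theorem exists_sum_sub_le {α β : ℕ → unitInterval} (hα : Antitone α) (hβ : Antitone β)
    (h : CompletelyEmbeds (diagSpace α) (diagSpace β)) :
    ∃ c K : ℝ, 0 ≤ K ∧ ∀ s : Finset ℕ, ∑ i ∈ s, ((α i : ℝ) ^ 2 - K * (β i : ℝ) ^ 2) ≤ c := by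
  obtain ⟨T, c, K, hc, hK, hT⟩ := CompletelyEmbeds.exists_clm h
  refine ⟨c, K * ‖T‖ ^ 2, by positivity, fun s => ?_⟩
  obtain ⟨n, hn⟩ : ∃ n, ∀ i ∈ s, i < n :=
    ⟨s.sup id + 1, fun i hi => Nat.lt_succ_of_le (Finset.le_sup (f := id) hi)⟩
  obtain ⟨J, hJ1, hJ2⟩ := exists_initial_embedding n
  let J' : EuclideanSpace ℂ (Fin n) →L[ℂ] Ell2 := J.toContinuousLinearMap
  have hscal (x) : ‖(((√K : ℝ) : ℂ) • (diagOp β ∘L T ∘L J')) x‖ ^ 2 =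
      K * ‖diagOp β (T (J x))‖ ^ 2 := by
    change ‖((√K : ℝ) : ℂ) • diagOp β (T (J x))‖ ^ 2 = _
    rw [norm_smul, mul_pow, Complex.norm_real, Real.norm_of_nonneg (Real.sqrt_nonneg _),
      Real.sq_sqrt hK]
  have key := sum_sub_le_of_orthonormalBasis (diagOp α ∘L J')
    (((√K : ℝ) : ℂ) • (diagOp β ∘L T ∘L J')) (c := c) ?_
    (fun i => (α i : ℝ) ^ 2) (fun i => K * ‖T‖ ^ 2 * (β i : ℝ) ^ 2) ?_
    -- The `i` equations are the vanishing of the first `i` coordinates of `T (J x)`; beyond them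
    -- `diag β` has norm at most `β i`.
    (LinearMap.pi fun i : Fin n =>
      (lp.evalₗ (𝕜 := ℂ) (fun _ : ℕ => ℂ) 2 (i : ℕ)) ∘ₗ (T ∘L J').toLinearMap) ?_
    (s.attachFin hn)
  · rw [← Finset.map_valEmbedding_attachFin hn, Finset.sum_map]
    exact key
  · intro b t
    classical
    have h2 (f : Fin n → ℝ) : ∑ i ∈ t, f i = ∑ i, if i ∈ t then f i else 0 := by simp
    -- Padding by zeros reduces the sum over `t` to a family indexed by `Fin n`.
    have h1 := hT n (fun i => if i ∈ t then J (b i) else 0) fun ζ => ?_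
    · rw [Finset.sum_sub_distrib, sub_le_iff_le_add]
      convert h1 using 1
      · rw [h2]
        refine Finset.sum_congr rfl fun i _ => ?_
        split_ifs <;> simp [J']
      · rw [h2, Finset.mul_sum]
        congr 1
        refine Finset.sum_congr rfl fun i _ => ?_
        split_ifs
        · exact hscal _
        · simp
    · have h3 : Orthonormal ℂ fun i => J (b i) := b.orthonormal.comp_linearIsometry J
      refine le_trans (le_of_eq ?_) (h3.sum_inner_products_le ζ (s := t))
      rw [h2]
      refine Finset.sum_congr rfl fun i _ => ?_
      split_ifs <;> simp
  · intro i x hx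
    have h1 := le_norm_sq_diagOp hα (i := i) (ξ := J x) fun j hj => ?_
    · simpa [J'] using h1
    · rcases lt_or_ge j n with hjn | hjn
      · rw [hJ1 x ⟨j, hjn⟩]
        exact hx _ hj
      · exact hJ2 x j hjn
  · intro i x hx
    have h1 := norm_sq_diagOp_le hβ (i := i) (ξ := T (J x)) fun j hj =>
      hx ⟨j, hj.trans i.2⟩ hj
    have h2 : ‖T (J x)‖ ^ 2 ≤ ‖T‖ ^ 2 * ‖x‖ ^ 2 := by
      rw [← mul_pow, ← J.norm_map x]
      exact pow_le_pow_left₀ (norm_nonneg _) (T.le_opNorm _) 2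
    rw [hscal]
    calc K * ‖diagOp β (T (J x))‖ ^ 2 ≤ K * ((β i : ℝ) ^ 2 * (‖T‖ ^ 2 * ‖x‖ ^ 2)) := by
          gcongr
          exact h1.trans (mul_le_mul_of_nonneg_left h2 (sq_nonneg _))
      _ = _ := by ring

theorem seqDominated_of_completelyEmbeds {α β : ℕ → unitInterval} (hα : Antitone α)
    (hβ : Antitone β) (h : CompletelyEmbeds (diagSpace α) (diagSpace β)) : SeqDominated α β := by
  obtain ⟨c, K, hK, hc⟩ := exists_sum_sub_le hα hβ h
  -- On this set `α i ^ 2 - K * β i ^ 2` exceeds half of `α i ^ 2`, hence the bound `2 * c` below.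
  -- The summand 1 keeps the constant positive when `K = 0`.
  refine ⟨{i | 2 * K * (β i : ℝ) ^ 2 < (α i : ℝ) ^ 2}, √(2 * K) + 1, by positivity, ?_, ?_⟩
  · refine summable_of_sum_le (c := 2 * c) (fun _ => sq_nonneg _) fun s => ?_
    have h1 := hc (s.map (Function.Embedding.subtype _))
    rw [Finset.sum_map] at h1
    have h2 : ∑ i ∈ s, ((α i : ℝ) ^ 2) / 2 ≤ c := by
      refine (Finset.sum_le_sum fun i _ => ?_).trans h1
      have := i.2
      simp only [Set.mem_ofPred_eq] at this
      simp only [Function.Embedding.coe_subtype]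
      linarith
    rw [← Finset.sum_div] at h2
    linarith
  · intro i hi
    have h1 : (α i : ℝ) ^ 2 ≤ 2 * K * (β i : ℝ) ^ 2 := not_lt.1 hi
    have hβ0 : (0 : ℝ) ≤ β i := (β i).2.1
    have h2 : (α i : ℝ) ≤ √(2 * K) * β i := by
      refine le_of_sq_le_sq ?_ (by positivity)
      rwa [mul_pow, Real.sq_sqrt (by positivity)]
    linarith

end Diagonal

/-! ### Sufficiency: constructing complete embeddings and isomorphisms -/

section Sufficiency

theorem completelyIsomorphic_of_range_eq {H K : Type*} [NormedAddCommGroup H]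
    [InnerProductSpace ℂ H] [NormedAddCommGroup K] [InnerProductSpace ℂ K]
    {X : OperatorSpace H} {Y : OperatorSpace K} {V : Type*} [AddCommGroup V] [Module ℂ V]
    (F : V →ₗ[ℂ] (H →L[ℂ] H)) (G : V →ₗ[ℂ] (K →L[ℂ] K))
    (hF : Function.Injective F) (hG : Function.Injective G)
    (hX : X.toSubmodule = LinearMap.range F) (hY : Y.toSubmodule = LinearMap.range G)
    (hFG : ∃ c : ℝ, ∀ (n : ℕ) (w : Matrix (Fin n) (Fin n) V),
      ‖blockOp (w.map G)‖ ≤ c * ‖blockOp (w.map F)‖)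
    (hGF : ∃ c : ℝ, ∀ (n : ℕ) (w : Matrix (Fin n) (Fin n) V),
      ‖blockOp (w.map F)‖ ≤ c * ‖blockOp (w.map G)‖) :
    CompletelyIsomorphic X Y := by
  let e := (LinearEquiv.ofInjective F hF).trans (LinearEquiv.ofEq _ _ hX.symm)
  let f := (LinearEquiv.ofInjective G hG).trans (LinearEquiv.ofEq _ _ hY.symm)
  have he (x) : F (e.symm x) = x := congrArg Subtype.val (e.apply_symm_apply x)
  have hf (x) : G (f.symm x) = x := congrArg Subtype.val (f.apply_symm_apply x)
  obtain ⟨c, hc⟩ := hFG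
  obtain ⟨d, hd⟩ := hGF
  refine ⟨e.symm.trans f, ⟨c, fun n v => ?_⟩, ⟨d, fun n v => ?_⟩⟩
  · have h1 : (v.map e.symm).map F = v.map (fun x => (x : H →L[ℂ] H)) :=
      Matrix.ext fun _ _ => he _
    have h := hc n (v.map e.symm)
    rw [h1] at h
    exact h
  · have h1 : (v.map f.symm).map G = v.map (fun x => (x : K →L[ℂ] K)) :=
      Matrix.ext fun _ _ => hf _
    have h := hd n (v.map f.symm)
    rw [h1] at h
    exact h

/-- `D` is completely bounded as a map from `R` to `C`. -/
def RowColBounded (D : Ell2 →L[ℂ] Ell2) : Prop :=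
  ∃ c : ℝ, 0 ≤ c ∧ ∀ (n : ℕ) (v : Matrix (Fin n) (Fin n) Ell2),
    colNorm (v.map D) ≤ c * rowNorm v

theorem RowColBounded.comp_left {D : Ell2 →L[ℂ] Ell2} (hD : RowColBounded D)
    (T : Ell2 →L[ℂ] Ell2) : RowColBounded (T ∘L D) := by
  obtain ⟨c, hc, h⟩ := hD
  refine ⟨‖T‖ * c, by positivity, fun n v => ?_⟩
  rw [mul_assoc]
  exact (colNorm_map_le T (v.map D)).trans (mul_le_mul_of_nonneg_left (h n v) (norm_nonneg _))

theorem RowColBounded.add {D E : Ell2 →L[ℂ] Ell2} (hD : RowColBounded D)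
    (hE : RowColBounded E) : RowColBounded (D + E) := by
  obtain ⟨c, hc, h⟩ := hD
  obtain ⟨d, hd, h'⟩ := hE
  refine ⟨c + d, by positivity, fun n v => ?_⟩
  rw [add_mul]
  exact (colNorm_add_le (v.map D) (v.map E)).trans (add_le_add (h n v) (h' n v))

theorem rowColBounded_diagOp {d : ℕ → unitInterval} (hd : Summable fun i => (d i : ℝ) ^ 2) :
    RowColBounded (diagOp d) :=
  ⟨_, Real.sqrt_nonneg _, fun _ v => colNorm_map_le_rowNorm _ _ (norm_diagOp_apply d) hd v⟩

/-- If `L T = 1`, while `B T` and `A` factor through each other up to maps that are completely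
bounded from `R` to `C`, then the amplified norms of `X(A)` and `X(B)` are comparable along `T`. -/
theorem norm_blockOp_graphMap_comparison {A B T L G G' R R' : Ell2 →L[ℂ] Ell2}
    (hL : L ∘L T = ContinuousLinearMap.id ℂ Ell2) (hR : RowColBounded R) (hR' : RowColBounded R')
    (hB : B ∘L T = G ∘L A + R) (hA : A = G' ∘L (B ∘L T) + R') :
    (∃ c : ℝ, ∀ (n : ℕ) (w : Matrix (Fin n) (Fin n) Ell2),
      ‖blockOp ((w.map T).map (graphMap B))‖ ≤ c * ‖blockOp (w.map (graphMap A))‖) ∧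
    ∃ c : ℝ, ∀ (n : ℕ) (w : Matrix (Fin n) (Fin n) Ell2),
      ‖blockOp (w.map (graphMap A))‖ ≤ c * ‖blockOp ((w.map T).map (graphMap B))‖ := by
  obtain ⟨r, hr, hR⟩ := hR
  obtain ⟨r', hr', hR'⟩ := hR'
  -- Each maximum pairs the row bound with the column bound. In the second, the row norm of `w` is
  -- recovered through `L`, so the error `R'` costs `r' * ‖L‖`.
  refine ⟨⟨max ‖T‖ (‖G‖ + r), fun n w => ?_⟩, ⟨max ‖L‖ (‖G'‖ + r' * ‖L‖), fun n w => ?_⟩⟩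
  · have h1 := rowNorm_le_norm_blockOp_graphMap A w
    have h2 := colNorm_le_norm_blockOp_graphMap A w
    set N := ‖blockOp (w.map (graphMap A))‖
    have hN : 0 ≤ N := (rowNorm_nonneg w).trans h1
    refine norm_blockOp_graphMap_le B _ ?_ ?_
    · calc rowNorm (w.map T) ≤ ‖T‖ * rowNorm w := rowNorm_map_le T w
        _ ≤ max ‖T‖ (‖G‖ + r) * N :=
            mul_le_mul (le_max_left _ _) h1 (rowNorm_nonneg w) (le_max_of_le_left (norm_nonneg T))
    · have h3 : (w.map T).map B = (w.map A).map G + w.map R :=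
        Matrix.ext fun i j => DFunLike.congr_fun hB (w i j)
      calc colNorm ((w.map T).map B) ≤ colNorm ((w.map A).map G) + colNorm (w.map R) := by
            rw [h3]
            exact colNorm_add_le _ _
        _ ≤ ‖G‖ * colNorm (w.map A) + r * rowNorm w :=
            add_le_add (colNorm_map_le _ _) (hR n w)
        _ ≤ ‖G‖ * N + r * N := by gcongr
        _ = (‖G‖ + r) * N := (add_mul _ _ _).symm
        _ ≤ max ‖T‖ (‖G‖ + r) * N := mul_le_mul_of_nonneg_right (le_max_right _ _) hN
  · have h1 := rowNorm_le_norm_blockOp_graphMap B (w.map T)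
    have h2 := colNorm_le_norm_blockOp_graphMap B (w.map T)
    set N := ‖blockOp ((w.map T).map (graphMap B))‖
    have hN : 0 ≤ N := (rowNorm_nonneg _).trans h1
    have h4 : rowNorm w ≤ ‖L‖ * N := by
      have hw : w = (w.map T).map L :=
        Matrix.ext fun i j => (DFunLike.congr_fun hL (w i j)).symm
      calc rowNorm w = rowNorm ((w.map T).map L) := by rw [← hw]
        _ ≤ ‖L‖ * rowNorm (w.map T) := rowNorm_map_le _ _
        _ ≤ ‖L‖ * N := by gcongr
    refine norm_blockOp_graphMap_le A _ ?_ ?_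
    · exact h4.trans (mul_le_mul_of_nonneg_right (le_max_left _ _) hN)
    · have h3 : w.map A = ((w.map T).map B).map G' + w.map R' :=
        Matrix.ext fun i j => DFunLike.congr_fun hA (w i j)
      calc colNorm (w.map A) ≤ colNorm (((w.map T).map B).map G') + colNorm (w.map R') := by
            rw [h3]
            exact colNorm_add_le _ _
        _ ≤ ‖G'‖ * colNorm ((w.map T).map B) + r' * rowNorm w :=
            add_le_add (colNorm_map_le _ _) (hR' n w)
        _ ≤ ‖G'‖ * N + r' * (‖L‖ * N) := by gcongr
        _ = (‖G'‖ + r' * ‖L‖) * N := by ring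
        _ ≤ max ‖L‖ (‖G'‖ + r' * ‖L‖) * N :=
            mul_le_mul_of_nonneg_right (le_max_right _ _) hN

/-- The left inverse `L` bounds `T` below, which makes the image of `X(A)` closed in `X(B)`. -/
theorem completelyEmbeds_graphSpace {A B T L G G' R R' : Ell2 →L[ℂ] Ell2}
    (hL : L ∘L T = ContinuousLinearMap.id ℂ Ell2) (hR : RowColBounded R) (hR' : RowColBounded R')
    (hB : B ∘L T = G ∘L A + R) (hA : A = G' ∘L (B ∘L T) + R') :
    CompletelyEmbeds (graphSpace A) (graphSpace B) := by
  obtain ⟨h1, h2⟩ := norm_blockOp_graphMap_comparison hL hR hR' hB hA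
  have hLT (ξ) : L (T ξ) = ξ := DFunLike.congr_fun hL ξ
  let F := graphMap B ∘ₗ T.toLinearMap
  have hFT (ξ) : F ξ = graphMap B (T ξ) := LinearMap.comp_apply _ _ _
  have hanti : AntilipschitzWith ‖L‖₊ F :=
    AddMonoidHomClass.antilipschitz_of_bound F fun ξ =>
      calc ‖ξ‖ = ‖L (T ξ)‖ := by rw [hLT]
        _ ≤ ‖L‖ * ‖T ξ‖ := L.le_opNorm _
        _ ≤ ‖L‖ * ‖F ξ‖ := by
          rw [hFT]
          exact mul_le_mul_of_nonneg_left (norm_le_norm_graphMap B _) (norm_nonneg L)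
  have hclosed : IsClosed (LinearMap.range F :
      Set (WithLp 2 (Ell2 × Ell2) →L[ℂ] WithLp 2 (Ell2 × Ell2))) := by
    have hc : Continuous F := (continuous_graphMap B).comp T.continuous
    have hu : UniformContinuous F := uniformContinuous_addMonoidHom_of_continuous hc
    rw [LinearMap.coe_range]
    exact hanti.isClosed_range hu
  refine ⟨⟨LinearMap.range F, hclosed⟩, ?_, ?_⟩
  · rintro _ ⟨ξ, rfl⟩
    exact ⟨T ξ, (hFT ξ).symm⟩
  · have hF (n : ℕ) (w : Matrix (Fin n) (Fin n) Ell2) :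
        (w.map T).map (graphMap B) = w.map F := Matrix.ext fun i j => (hFT (w i j)).symm
    simp only [hF] at h1 h2
    exact completelyIsomorphic_of_range_eq (graphMap A) F (graphMap_injective A) hanti.injective
      rfl rfl h1 h2

theorem completelyIsomorphic_graphSpace {A B G G' R R' : Ell2 →L[ℂ] Ell2}
    (hR : RowColBounded R) (hR' : RowColBounded R') (hB : B = G ∘L A + R)
    (hA : A = G' ∘L B + R') : CompletelyIsomorphic (graphSpace A) (graphSpace B) := by
  obtain ⟨h1, h2⟩ := norm_blockOp_graphMap_comparison (A := A) (B := B)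
    (T := ContinuousLinearMap.id ℂ Ell2) (L := ContinuousLinearMap.id ℂ Ell2)
    (ContinuousLinearMap.comp_id _) hR hR'
    ((ContinuousLinearMap.comp_id _).trans hB) (by rwa [ContinuousLinearMap.comp_id])
  have hid (n : ℕ) (w : Matrix (Fin n) (Fin n) Ell2) :
      w.map (ContinuousLinearMap.id ℂ Ell2) = w := Matrix.ext fun _ _ => rfl
  simp only [hid] at h1 h2
  exact completelyIsomorphic_of_range_eq (graphMap A) (graphMap B) (graphMap_injective A)
    (graphMap_injective B) rfl rfl h1 h2

theorem diagOp_ext {D E : Ell2 →L[ℂ] Ell2} (h : ∀ ξ i, D ξ i = E ξ i) : D = E :=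
  ContinuousLinearMap.ext fun ξ => lp.ext (funext (h ξ))

/-- If `α ≤ K β` off a set on which `α` is square-summable, then `diag α` factors through `diag β`
up to a Hilbert–Schmidt diagonal operator. -/
theorem exists_diagOp_eq_comp_add {α β : ℕ → unitInterval} {S : Set ℕ} {K : ℝ} (hK : 0 < K)
    (hS : Summable fun i : S => (α i : ℝ) ^ 2) (h : ∀ i ∉ S, (α i : ℝ) ≤ K * (β i : ℝ)) :
    ∃ G R : Ell2 →L[ℂ] Ell2, RowColBounded R ∧ diagOp α = G ∘L diagOp β + R := by
  classical
  let d : ℕ → unitInterval := fun i => if i ∈ S then α i else 0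
  -- Where `β i = 0` off `S`, also `α i = 0`, and division by zero gives the harmless value 0.
  let g : ℕ → unitInterval := fun i => if hi : i ∈ S then 0 else
    ⟨α i / (K * β i), div_nonneg (α i).2.1 (mul_nonneg hK.le (β i).2.1),
      div_le_one_of_le₀ (h i hi) (mul_nonneg hK.le (β i).2.1)⟩
  refine ⟨(K : ℂ) • diagOp g, diagOp d, rowColBounded_diagOp ?_, diagOp_ext fun ξ i => ?_⟩
  · have h1 := summable_subtype_iff_indicator (f := fun i => (α i : ℝ) ^ 2).1 hS
    refine h1.congr fun i => ?_
    by_cases hi : i ∈ S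
    · simp only [d, if_pos hi, Set.indicator_of_mem hi]
    · simp only [d, if_neg hi, Set.indicator_of_notMem hi]
      norm_num
  · have h1 : (((K : ℂ) • diagOp g) ∘L diagOp β + diagOp d) ξ i =
        (K : ℂ) * diagOp g (diagOp β ξ) i + diagOp d ξ i := by
      rw [add_apply, ContinuousLinearMap.comp_apply,
        smul_apply, lp.coeFn_add, Pi.add_apply, lp.coeFn_smul, Pi.smul_apply,
        smul_eq_mul]
    rw [h1]
    simp only [diagOp_apply]
    by_cases hi : i ∈ S
    · simp [d, g, hi]
    · simp only [d, g, hi, dite_false, if_false]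
      have h2 := h i hi
      rcases eq_or_ne (β i : ℝ) 0 with hb | hb
      · have ha : (α i : ℝ) = 0 := le_antisymm (by simpa [hb] using h2) (α i).2.1
        simp [ha]
      · have hb' : ((β i : ℝ) : ℂ) ≠ 0 := by exact_mod_cast hb
        have hK' : (K : ℂ) ≠ 0 := by exact_mod_cast hK.ne'
        push_cast
        field_simp
        simp [mul_comm]

theorem norm_diagOp_le (α : ℕ → unitInterval) : ‖diagOp α‖ ≤ 1 :=
  lp.norm_mapCLM_le ..

/-- The isometry of `ℓ₂` induced by an injection of the index set. -/
theorem exists_isometry_of_injective {σ : ℕ → ℕ} (hσ : Function.Injective σ) :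
    ∃ V : Ell2 →ₗᵢ[ℂ] Ell2, ∀ β : ℕ → unitInterval,
      diagOp β ∘L V.toContinuousLinearMap =
        V.toContinuousLinearMap ∘L diagOp fun i => β (σ i) := by
  have ho : Orthonormal ℂ fun i => (lp.single 2 (σ i) (1 : ℂ) : Ell2) := by
    refine ⟨fun i => by simp [lp.norm_single], fun i j hij => ?_⟩
    simp [lp.inner_single_left, hσ.ne hij]
  have hV (i : ℕ) (z : ℂ) : ho.orthogonalFamily.linearIsometry (lp.single 2 i z) =
      lp.single 2 (σ i) z := by
    rw [OrthogonalFamily.linearIsometry_apply_single, LinearIsometry.toSpanSingleton_apply,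
      ← lp.single_smul, smul_eq_mul, mul_one]
  have hd (α : ℕ → unitInterval) (i : ℕ) (z : ℂ) : diagOp α (lp.single 2 i z) =
      lp.single 2 i (((α i : ℝ) : ℂ) * z) := by
    refine lp.ext (funext fun j => ?_)
    rw [diagOp_apply]
    rcases eq_or_ne j i with rfl | hj
    · simp
    · simp [hj]
  refine ⟨ho.orthogonalFamily.linearIsometry, fun β => ?_⟩
  refine lp.ext_continuousLinearMap (by simp) fun i => ContinuousLinearMap.ext fun z => ?_
  change diagOp β (ho.orthogonalFamily.linearIsometry (lp.single 2 i z)) =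
    ho.orthogonalFamily.linearIsometry (diagOp _ (lp.single 2 i z))
  rw [hV, hd, hd, hV]

theorem exists_left_inverse (V : Ell2 →ₗᵢ[ℂ] Ell2) {D : Ell2 →L[ℂ] Ell2} (hD : ‖D‖ ≤ 1) :
    ∃ L : Ell2 →L[ℂ] Ell2,
      L ∘L (D + (2 : ℂ) • V.toContinuousLinearMap) = ContinuousLinearMap.id ℂ Ell2 := by
  set V' := V.toContinuousLinearMap
  have hV : V'.adjoint ∘L V' = 1 := by
    refine ContinuousLinearMap.ext fun ξ => ext_inner_right ℂ fun ζ => ?_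
    simp [V']
  have hV1 : ‖V'‖ ≤ 1 := V.norm_toContinuousLinearMap_le
  -- `(1/2) V* (D + 2 V) = 1 - W` with `‖W‖ ≤ 1/2`, so a Neumann series inverts it.
  let W : Ell2 →L[ℂ] Ell2 := -((1 / 2 : ℂ) • (V'.adjoint ∘L D))
  have hW : ‖W‖ < 1 := by
    have h1 : ‖V'.adjoint ∘L D‖ ≤ 1 * 1 := by
      refine (ContinuousLinearMap.opNorm_comp_le _ _).trans ?_
      rw [LinearIsometryEquiv.norm_map]
      gcongr
    rw [norm_neg, norm_smul]
    norm_num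
    linarith
  obtain ⟨u, hu⟩ := isUnit_one_sub_of_norm_lt_one hW
  refine ⟨(↑u⁻¹ : Ell2 →L[ℂ] Ell2) ∘L ((1 / 2 : ℂ) • V'.adjoint), ?_⟩
  have h1 : ((1 / 2 : ℂ) • V'.adjoint) ∘L (D + (2 : ℂ) • V') = (u : Ell2 →L[ℂ] Ell2) := by
    rw [hu, ContinuousLinearMap.comp_add, ContinuousLinearMap.smul_comp,
      ContinuousLinearMap.smul_comp, ContinuousLinearMap.comp_smul, hV, smul_smul]
    norm_num [W, add_comm]
  rw [ContinuousLinearMap.comp_assoc, h1]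
  exact u.inv_mul

theorem completelyEmbeds_of_seqDominated {α β : ℕ → unitInterval}
    (hβ : Tendsto (fun i => (β i : ℝ)) atTop (𝓝 0)) (h : SeqDominated α β) :
    CompletelyEmbeds (diagSpace α) (diagSpace β) := by
  classical
  obtain ⟨S, K, hK, hS, hαβ⟩ := h
  -- Since `β` tends to 0, it is square-summable along a sparse subsequence, where `V` will place
  -- its range.
  obtain ⟨σ, hσ, hσβ⟩ := extraction_forall_of_eventually (P := fun n k => (β k : ℝ) < (1 / 2) ^ n)
    fun n => hβ.eventually_lt_const (by positivity)
  obtain ⟨V, hV⟩ := exists_isometry_of_injective hσ.injective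
  -- With this choice `β i * t i` is `min (β i) (α i)` off `S`, and zero on `S`. The embedding is
  -- induced by `T = diag t + 2 V`.
  let t : ℕ → unitInterval := fun i => if i ∈ S then 0 else
    ⟨min 1 ((α i : ℝ) / β i), le_min zero_le_one (div_nonneg (α i).2.1 (β i).2.1), min_le_left _ _⟩
  obtain ⟨L, hL⟩ := exists_left_inverse V (norm_diagOp_le t)
  have hγα (i) : ((β i * t i : unitInterval) : ℝ) ≤ 1 * α i := by
    by_cases hi : i ∈ S
    · simpa [t, hi] using (α i).2.1
    · rcases eq_or_ne (β i : ℝ) 0 with hb | hb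
      · simpa [hb] using (α i).2.1
      · have hb' : 0 < (β i : ℝ) := lt_of_le_of_ne (β i).2.1 hb.symm
        simp only [t, hi, if_false, Set.Icc.coe_mul, one_mul]
        calc (β i : ℝ) * min 1 (α i / β i : ℝ) ≤ β i * (α i / β i : ℝ) := by
              gcongr; exact min_le_right _ _
          _ = α i := mul_div_cancel₀ _ hb
  have hαγ (i) (hi : i ∉ S) : (α i : ℝ) ≤ max K 1 * ((β i * t i : unitInterval) : ℝ) := by
    have h1 := hαβ i hi
    rcases eq_or_ne (β i : ℝ) 0 with hb | hb
    · simpa [hb] using h1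
    · have hb' : 0 < (β i : ℝ) := lt_of_le_of_ne (β i).2.1 hb.symm
      simp only [t, hi, if_false, Set.Icc.coe_mul]
      rw [mul_min_of_nonneg _ _ hb'.le, mul_one, mul_div_cancel₀ _ hb]
      rcases min_cases (β i : ℝ) (α i : ℝ) with ⟨he, -⟩ | ⟨he, -⟩ <;> rw [he]
      · exact h1.trans (mul_le_mul_of_nonneg_right (le_max_left _ _) hb'.le)
      · exact le_mul_of_one_le_left (α i).2.1 (le_max_right _ _)
  obtain ⟨G, R, hR, hG⟩ := exists_diagOp_eq_comp_add (α := fun i => β i * t i) (β := α) (S := ∅)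
    one_pos (by simp) fun i _ => hγα i
  obtain ⟨G', R', hR', hG'⟩ := exists_diagOp_eq_comp_add (β := fun i => β i * t i)
    (lt_max_of_lt_right one_pos) hS hαγ
  have hE : RowColBounded (diagOp fun i => β (σ i)) := by
    refine rowColBounded_diagOp (Summable.of_nonneg_of_le (fun _ => sq_nonneg _) (fun i => ?_)
      summable_geometric_two)
    have h1 : (β (σ i) : ℝ) ^ 2 ≤ β (σ i) := by
      have := (β (σ i)).2.1
      have := (β (σ i)).2.2
      nlinarith
    exact h1.trans (hσβ i).le
  set V' := V.toContinuousLinearMap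
  set E := diagOp fun i => β (σ i)
  have hBT : diagOp β ∘L (diagOp t + (2 : ℂ) • V') =
      diagOp (fun i => β i * t i) + ((2 : ℂ) • V') ∘L E := by
    rw [ContinuousLinearMap.comp_add, ContinuousLinearMap.comp_smul, hV,
      ContinuousLinearMap.smul_comp]
    congr 1
    refine diagOp_ext fun ξ i => ?_
    simp [diagOp_apply, mul_assoc]
  -- The second correction in `R'` cancels the term `G' ∘ 2 V ∘ E` that arises from applying `G'` to
  -- `diag β ∘ T`.
  refine completelyEmbeds_graphSpace (G := G) (G' := G') (R := R + ((2 : ℂ) • V') ∘L E)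
    (R' := R' + (-(G' ∘L ((2 : ℂ) • V'))) ∘L E) hL (hR.add (hE.comp_left _))
    (hR'.add (hE.comp_left _)) ?_ ?_
  · rw [hBT, hG, add_assoc]
  · rw [hBT, ContinuousLinearMap.comp_add, ContinuousLinearMap.neg_comp,
      ContinuousLinearMap.comp_assoc]
    nth_rw 1 [hG']
    abel

theorem completelyIsomorphic_of_seqEquiv {α β : ℕ → unitInterval} (h : SeqEquiv α β) :
    CompletelyIsomorphic (diagSpace α) (diagSpace β) := by
  obtain ⟨⟨S, K, hK, hS, hβα⟩, ⟨S', K', hK', hS', hαβ⟩⟩ := h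
  obtain ⟨G, R, hR, hG⟩ := exists_diagOp_eq_comp_add hK hS hβα
  obtain ⟨G', R', hR', hG'⟩ := exists_diagOp_eq_comp_add hK' hS' hαβ
  exact completelyIsomorphic_graphSpace hR hR' hG hG'

theorem CompletelyIsomorphic.symm {H K : Type*} [NormedAddCommGroup H] [InnerProductSpace ℂ H]
    [NormedAddCommGroup K] [InnerProductSpace ℂ K] {X : OperatorSpace H} {Y : OperatorSpace K}
    (h : CompletelyIsomorphic X Y) : CompletelyIsomorphic Y X := by
  obtain ⟨u, h1, h2⟩ := h
  exact ⟨u.symm, h2, h1⟩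

theorem CompletelyIsomorphic.completelyEmbeds {H K : Type*} [NormedAddCommGroup H]
    [InnerProductSpace ℂ H] [NormedAddCommGroup K] [InnerProductSpace ℂ K] {X : OperatorSpace H}
    {Y : OperatorSpace K} (h : CompletelyIsomorphic X Y) : CompletelyEmbeds X Y :=
  ⟨Y, le_rfl, h⟩

end Sufficiency

end OperatorSpace

/-! ### The classification theorem -/

theorem mainTheorem2 (α β : ℕ → unitInterval) (hα : α ∈ nullSequences) (hβ : β ∈ nullSequences) :
    (OperatorSpace.CompletelyEmbeds (OperatorSpace.diagSpace α) (OperatorSpace.diagSpace β) ↔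
      SeqDominated α β) ∧
    [OperatorSpace.CompletelyIsomorphic (OperatorSpace.diagSpace α) (OperatorSpace.diagSpace β),
      OperatorSpace.CompletelyEmbeds (OperatorSpace.diagSpace α) (OperatorSpace.diagSpace β) ∧
        OperatorSpace.CompletelyEmbeds (OperatorSpace.diagSpace β) (OperatorSpace.diagSpace α),
      SeqEquiv α β].TFAE := by
  refine ⟨⟨OperatorSpace.seqDominated_of_completelyEmbeds hα.1 hβ.1,
    OperatorSpace.completelyEmbeds_of_seqDominated hβ.2⟩, ?_⟩
  tfae_have 1 → 2 := fun h => ⟨h.completelyEmbeds, h.symm.completelyEmbeds⟩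
  tfae_have 2 → 3 := fun h => ⟨OperatorSpace.seqDominated_of_completelyEmbeds hβ.1 hα.1 h.2,
    OperatorSpace.seqDominated_of_completelyEmbeds hα.1 hβ.1 h.1⟩
  tfae_have 3 → 1 := OperatorSpace.completelyIsomorphic_of_seqEquiv
  tfae_finish
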